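/- Let $d\ge 1$, let $S=\mathbb R/\mathbb Z$ with normalized Lebesgue measure $ds$, and let $A$ be a continuous map from $S$ to the real $d\times d$ matrices such that every $A(s)$ is Metzler (nonnegative off-diagonal entries). Assume that the average $\bar A=\int_S A(s)\,ds$ is irreducible, i.e. for all $i,j$ there is a sequence $i=i_1,i_2,\dots,i_n=j$, $n\ge 1$, with $\bar A_{i_l i_{l+1}}>0$ for $1\le l<n$. Let $\Delta=\{x\in\mathbb R^d: x_i\ge 0,\ \sum_i x_i=1\}$, let $\mathbf 1=(1,\dots,1)$, and let $$F(s,\theta)=A(s)\theta-\langle A(s)\theta,\mathbf 1\rangle\,\theta,\qquad (s,\theta)\in S\times\Delta .$$ For $s\in S$ put $\omega_t=s+t \pmod 1$ and consider the equation in $\Delta$ $$\frac{d\theta}{dt}=F(\omega_t,\theta).\qquad (*)$$ For every $s\in S$ and $\theta_0\in\Delta$, $(*)$ has a unique solution $(\theta(t))_{t\ge 0}$ in $\Delta$ with $\theta(0)=\theta_0$; write $\Psi_t(s,\theta_0)=\theta(t)$. There exists a continuous $1$-periodic function $\theta^*:\mathbb R\to\Delta$ such that the following hold. 1. For all $s$,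 with $\omega_t=s+t\pmod 1$, the function $t\mapsto\theta^*(s+t)$ is the unique $1$-periodic solution of $(*)$. 2. It is globally asymptotically stable, in the sense that $\lim_{t\to\infty}\|\theta(t)-\theta^*(s+t)\|=0$ for every solution $(\theta(t))_{t\ge0}$ of $(*)$ in $\Delta$ with $\omega_t=s+t\pmod 1$. 3. The process $(\omega_t,\theta_t)$, whose semigroup is $Q_tf(s,\theta)=f(s+t,\Psi_t(s,\theta))$, has a unique invariant probability $\pi$ on $S\times\Delta$ (that is, a unique probability $\pi$ with $\int Q_tf\,d\pi=\int f\,d\pi$ for all $t\ge0$ and all bounded Borel $f$), and $$\pi(ds\,d\theta)=ds\,\delta_{\theta^*(s)}(d\theta).$$ 4. The top Lyapunov exponent $\Lambda=\int_{S\times\Delta}\langle A(s)\theta,\mathbf 1\rangle\,\pi(ds\,d\theta)$ satisfies $$\Lambda=\int_0^1\langle A(s)\theta^*(s),\mathbf 1\rangle\,ds .$$ -/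

import Mathlib

open Set Filter Topology MeasureTheory
open scoped Matrix

namespace Cooperative

/-- The unit simplex `Δ = {x ∈ ℝ^d : x_i ≥ 0, ∑ x_i = 1}`, as a type. -/
abbrev Simplex (d : ℕ) : Type := stdSimplex ℝ (Fin d)

/-- A Metzler matrix: the off-diagonal entries are nonnegative. -/
def IsMetzler {d : ℕ} (M : Matrix (Fin d) (Fin d) ℝ) : Prop :=
  ∀ i j, i ≠ j → 0 ≤ M i j

/-- Irreducibility: any `i` is joined to any `j` by a chain `i = i₁, i₂, …, iₙ = j` (with `n ≥ 1`)
along which all the entries `M i_l i_{l+1}` are positive. -/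
def IsIrreducible {d : ℕ} (M : Matrix (Fin d) (Fin d) ℝ) : Prop :=
  ∀ i j, Relation.ReflTransGen (fun k l => 0 < M k l) i j

/-- The entrywise average `∫ A(s) μ(ds)`. -/
noncomputable def averageMatrix {S : Type*} [MeasurableSpace S] {d : ℕ}
    (A : S → Matrix (Fin d) (Fin d) ℝ) (μ : Measure S) : Matrix (Fin d) (Fin d) ℝ :=
  Matrix.of fun i j => ∫ s, A s i j ∂μ

/-- The growth rate `⟨A(s) θ, 𝟏⟩`. -/
def growthRate {S : Type*} {d : ℕ} (A : S → Matrix (Fin d) (Fin d) ℝ) (s : S)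
    (θ : Simplex d) : ℝ :=
  (A s *ᵥ (θ : Fin d → ℝ)) ⬝ᵥ 1

/-- The vector field `F(s, θ) = A(s) θ - ⟨A(s) θ, 𝟏⟩ θ`. -/
def simplexField {S : Type*} {d : ℕ} (A : S → Matrix (Fin d) (Fin d) ℝ) (s : S)
    (θ : Simplex d) : Fin d → ℝ :=
  A s *ᵥ (θ : Fin d → ℝ) - growthRate A s θ • (θ : Fin d → ℝ)

/-- `θ` solves `dθ/dt = F(ω_t, θ)` in the simplex, for `t` in the interval `I`
(one-sided derivatives at the end points of `I`). -/
def IsSimplexSolution {S : Type*} {d : ℕ} (A : S → Matrix (Fin d) (Fin d) ℝ) (ω : ℝ → S)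
    (I : Set ℝ) (θ : ℝ → Simplex d) : Prop :=
  ∀ t ∈ I, HasDerivWithinAt (fun u => (θ u : Fin d → ℝ)) (simplexField A (ω t) (θ t)) I t

/-- The periodic driving path `ω_t = s + t (mod 1)` on `S = ℝ/ℤ`. -/
def rotationPath (s : UnitAddCircle) (t : ℝ) : UnitAddCircle := s + (t : UnitAddCircle)

open Classical in
/-- `Ψ(t, ω)(θ₀)`, where `ω_t = s + t (mod 1)`: the value at time `t` of the solution, on
`[0, ∞)`, that starts at `θ₀`. (The fallback value is never used: see `WellPosed`, which is part
of what the theorem asserts.) -/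
noncomputable def simplexFlow {d : ℕ} (A : UnitAddCircle → Matrix (Fin d) (Fin d) ℝ)
    (s : UnitAddCircle) (θ₀ : Simplex d) (t : ℝ) : Simplex d :=
  if h : ∃ θ : ℝ → Simplex d, IsSimplexSolution A (rotationPath s) (Ici 0) θ ∧ θ 0 = θ₀ then
    h.choose t
  else θ₀

/-- Existence and uniqueness, on `[0, ∞)`, for the initial value problem in the simplex. -/
def WellPosed {d : ℕ} (A : UnitAddCircle → Matrix (Fin d) (Fin d) ℝ) : Prop :=
  ∀ (s : UnitAddCircle) (θ₀ : Simplex d),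
    (∃ θ : ℝ → Simplex d, IsSimplexSolution A (rotationPath s) (Ici 0) θ ∧ θ 0 = θ₀) ∧
    ∀ θ θ' : ℝ → Simplex d,
      IsSimplexSolution A (rotationPath s) (Ici 0) θ → θ 0 = θ₀ →
      IsSimplexSolution A (rotationPath s) (Ici 0) θ' → θ' 0 = θ₀ → EqOn θ θ' (Ici 0)

/-- The semigroup of the (here deterministic) Markov process `(ω_t, θ_t)` on `S × Δ`:
`Q_t f (s, θ) = f (s + t, Ψ(t, ω)(θ))`. -/
noncomputable def semigroup {d : ℕ} (A : UnitAddCircle → Matrix (Fin d) (Fin d) ℝ) (t : ℝ)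
    (f : UnitAddCircle × Simplex d → ℝ) (p : UnitAddCircle × Simplex d) : ℝ :=
  f (rotationPath p.1 t, simplexFlow A p.1 p.2 t)

/-- `π` is an invariant probability of `(ω_t, θ_t)`: `π(Q_t f) = π(f)` for all `t ≥ 0` and all
bounded Borel functions `f`. -/
def IsInvariantProbability {d : ℕ} (A : UnitAddCircle → Matrix (Fin d) (Fin d) ℝ)
    (π : Measure (UnitAddCircle × Simplex d)) : Prop :=
  IsProbabilityMeasure π ∧
    ∀ t : ℝ, 0 ≤ t → ∀ f : UnitAddCircle × Simplex d → ℝ, Measurable f →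
      (∃ C, ∀ p, |f p| ≤ C) → ∫ p, semigroup A t f p ∂π = ∫ p, f p ∂π

/-- `Λ = ∫ ⟨A(s) θ, 𝟏⟩ π(ds dθ)`, for `π` the invariant probability. -/
noncomputable def topLyapunov {d : ℕ} (A : UnitAddCircle → Matrix (Fin d) (Fin d) ℝ)
    (π : Measure (UnitAddCircle × Simplex d)) : ℝ :=
  ∫ p, growthRate A p.1 p.2 ∂π

/-- The measure `ds δ_{θ(s)}(dθ)` on `S × Δ`, with `S = ℝ/ℤ` identified with `[0, 1)`: the image
of Lebesgue measure on `[0, 1)` under `s ↦ (s, θ(s))`. -/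
noncomputable def graphMeasure {d : ℕ} (θ : ℝ → Simplex d) :
    Measure (UnitAddCircle × Simplex d) :=
  (volume.restrict (Ico (0 : ℝ) 1)).map fun s : ℝ => ((s : UnitAddCircle), θ s)

end Cooperative

/-! The equation in the simplex is the projection of the linear equation `y' = A y` under `y ↦ y / ∑
i, y i`. Replacing `A` by `A + c • 1` leaves the projected field unchanged, so all entries may be
taken nonnegative; nonnegative linear solutions are then nondecreasing in each coordinate.

Irreducibility of the average makes the solution operator over `N` periods entrywise positive
(`exists_uniform_lower_bound`). A positive operator contracts the oscillation of the ratios `x i / y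
i` by a fixed factor (`oscillation_contraction`), as in the Perron–Frobenius–Birkhoff argument.
Hence any two solutions in the simplex with the same phase merge
(`tendsto_sub_of_isSimplexSolution`).

Merging of a solution with its own shift by one period, plus compactness, gives a fixed point of the
period map, hence the periodic solution; merging also gives its uniqueness and stability. An
invariant probability has Lebesgue first marginal, by uniqueness of Haar measure, and along integer
times the flow pushes it onto the graph of the periodic solution, which determines it. -/

namespace Cooperative

/-! ### Picard series for linear equations depending on a parameter -/

section PicardSeries

variable {X E : Type*} [NormedAddCommGroup E] [NormedSpace ℝ E]

/-- The terms of the Picard series of the linear equation `y' = L p t y`, `y 0 = v p`. -/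
noncomputable def picardTerm (L : X → ℝ → E →L[ℝ] E) (v : X → E) : ℕ → X → ℝ → E
  | 0, p, _ => v p
  | k + 1, p, t => ∫ u in (0 : ℝ)..t, L p u (picardTerm L v k p u)

/-- The solution of `y' = L p t y`, `y 0 = v p`, as the sum of the Picard series. -/
noncomputable def picardSum (L : X → ℝ → E →L[ℝ] E) (v : X → E) (p : X) (t : ℝ) : E :=
  ∑' k, picardTerm L v k p t

variable {L : X → ℝ → E →L[ℝ] E} {v : X → E} {K C : ℝ}

lemma picardSum_zero (p : X) : picardSum L v p 0 = v p := by
  rw [picardSum, tsum_eq_single 0]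
  · rfl
  · intro k hk
    obtain ⟨k, rfl⟩ := Nat.exists_eq_succ_of_ne_zero hk
    simp [picardTerm]

lemma norm_picardTerm_le (hL : ∀ p t, ‖L p t‖ ≤ K) (hv : ∀ p, ‖v p‖ ≤ C) (k : ℕ) (p : X) (t : ℝ) :
    ‖picardTerm L v k p t‖ ≤ C * (K * |t|) ^ k / k.factorial := by
  have hK : 0 ≤ K := (norm_nonneg _).trans (hL p 0)
  induction k generalizing t with
  | zero => simpa [picardTerm] using hv p
  | succ k ih =>
    have hint : IntegrableOn (fun u => K * (C * (K * |u|) ^ k / k.factorial)) (uIoc 0 t) := by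
      refine Continuous.integrableOn_uIoc ?_
      fun_prop
    calc ‖picardTerm L v (k + 1) p t‖
        ≤ ∫ u in uIoc 0 t, ‖L p u (picardTerm L v k p u)‖ :=
          intervalIntegral.norm_integral_le_integral_norm_uIoc
      _ ≤ ∫ u in uIoc 0 t, K * (C * (K * |u|) ^ k / k.factorial) := by
          refine integral_mono_of_nonneg (ae_of_all _ fun u => norm_nonneg _) hint
            (ae_of_all _ fun u => ?_)
          exact (ContinuousLinearMap.le_opNorm _ _).trans
            (mul_le_mul (hL p u) (ih u) (norm_nonneg _) hK)
      _ = ∫ u in uIoc 0 t, (K * (C * K ^ k / k.factorial)) * |u - 0| ^ k := by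
          congr 1 with u
          rw [mul_pow, sub_zero]; ring
      _ = C * (K * |t|) ^ (k + 1) / (k + 1).factorial := by
          rw [integral_const_mul, integral_pow_abs_sub_uIoc, Nat.factorial_succ]
          push_cast
          field_simp
          simp
          ring

lemma summable_picardBound (C a : ℝ) : Summable fun k : ℕ => C * a ^ k / k.factorial := by
  simpa [mul_div_assoc] using (Real.summable_pow_div_factorial a).mul_left C

/-- Every Picard term is an iterated integral of nonnegative quantities, so positivity of the
solution is read off term by term. -/
lemma picardSum_nonneg {ι : Type*} [Fintype ι] {L : X → ℝ → (ι → ℝ) →L[ℝ] (ι → ℝ)}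
    {v : X → ι → ℝ} (hcont : ∀ k p, Continuous (picardTerm L v k p))
    (hLc : ∀ p, Continuous (L p))
    (hpos : ∀ p t w, 0 ≤ w → 0 ≤ L p t w) (hv0 : ∀ p, 0 ≤ v p) (p : X) {t : ℝ} (ht : 0 ≤ t) :
    0 ≤ picardSum L v p t := by
  have hk : ∀ k t, 0 ≤ t → 0 ≤ picardTerm L v k p t := by
    intro k
    induction k with
    | zero => intro t _; exact hv0 p
    | succ k ih =>
      intro t ht i
      have hc : Continuous fun u => L p u (picardTerm L v k p u) := (hLc p).clm_apply (hcont k p)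
      have h : picardTerm L v (k + 1) p t i
          = ∫ u in (0 : ℝ)..t, L p u (picardTerm L v k p u) i :=
        ((ContinuousLinearMap.proj (R := ℝ) (φ := fun _ : ι => ℝ) i).intervalIntegral_comp_comm
          (hc.intervalIntegrable 0 t)).symm
      rw [h]
      exact intervalIntegral.integral_nonneg ht fun u hu => hpos p u _ (ih u hu.1) i
  exact tsum_nonneg fun k => hk k t ht

variable [TopologicalSpace X] 

lemma continuous_picardTerm (hL : Continuous (Function.uncurry L)) (hv : Continuous v) (k : ℕ) :
    Continuous (Function.uncurry (picardTerm L v k)) := by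
  induction k with
  | zero => exact hv.comp continuous_fst
  | succ k ih =>
    have : Continuous (Function.uncurry fun p u => L p u (picardTerm L v k p u)) := hL.clm_apply ih
    exact intervalIntegral.continuous_parametric_primitive_of_continuous this

lemma continuous_picardSum [CompleteSpace E] (hL : Continuous (Function.uncurry L)) (hv : Continuous v)
    (hLK : ∀ p t, ‖L p t‖ ≤ K) (hvC : ∀ p, ‖v p‖ ≤ C) (t : ℝ) :
    Continuous fun p => picardSum L v p t :=
  continuous_tsum (fun k => (continuous_picardTerm hL hv k).comp
    (by fun_prop : Continuous fun p => (p, t)))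
    (summable_picardBound C (K * |t|)) fun k p => norm_picardTerm_le hLK hvC k p t

/-- Termwise differentiation: term `k + 1` has derivative `L` applied to term `k`. -/
lemma hasDerivAt_picardSum [CompleteSpace E] (hL : Continuous (Function.uncurry L))
    (hv : Continuous v) (hLK : ∀ p t, ‖L p t‖ ≤ K) (hvC : ∀ p, ‖v p‖ ≤ C) (p : X) (t : ℝ) :
    HasDerivAt (picardSum L v p) (L p t (picardSum L v p t)) t := by
  have hK : 0 ≤ K := (norm_nonneg _).trans (hLK p 0)
  have hC : 0 ≤ C := (norm_nonneg _).trans (hvC p)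
  have hLp : Continuous (L p) := hL.comp (by fun_prop : Continuous fun u => (p, u))
  have hcont : ∀ k, Continuous (picardTerm L v k p) := fun k =>
    (continuous_picardTerm hL hv k).comp (by fun_prop : Continuous fun u => (p, u))
  have hsum : ∀ t, Summable fun k => picardTerm L v k p t := fun t =>
    .of_norm_bounded (summable_picardBound C (K * |t|)) fun k => norm_picardTerm_le hLK hvC k p t
  -- The factorial bound on the derivatives is uniform only on bounded time intervals.
  set R := |t| + 1
  have hbound : ∀ k, ∀ u ∈ Ioo (-R) R, ‖L p u (picardTerm L v k p u)‖
      ≤ K * (C * (K * R) ^ k / k.factorial) := by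
    intro k u hu
    refine (ContinuousLinearMap.le_opNorm _ _).trans (mul_le_mul (hLK p u)
      ((norm_picardTerm_le hLK hvC k p u).trans ?_) (norm_nonneg _) hK)
    have : |u| ≤ R := (abs_lt.2 hu).le
    gcongr
  have h1 : HasDerivAt (fun u => ∑' k, picardTerm L v (k + 1) p u)
      (∑' k, L p t (picardTerm L v k p t)) t := by
    have ht : t ∈ Ioo (-R) R := abs_lt.1 (lt_add_one _)
    refine hasDerivAt_tsum_of_isPreconnected ((summable_picardBound C (K * R)).mul_left K)
      isOpen_Ioo isPreconnected_Ioo (fun k u hu => ?_) hbound ht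
      ((summable_nat_add_iff 1).2 (hsum t)) ht
    exact (hLp.clm_apply (hcont k)).integral_hasStrictDerivAt 0 u |>.hasDerivAt
  have h2 : picardSum L v p = fun u => v p + ∑' k, picardTerm L v (k + 1) p u := by
    ext u
    exact (hsum u).tsum_eq_zero_add
  rw [(by exact (L p t).map_tsum (hsum t) :
    L p t (picardSum L v p t) = ∑' k, L p t (picardTerm L v k p t)), h2]
  exact h1.const_add _

end PicardSeries

/-! ### Linear systems with nonnegative coefficients -/

section NonnegSystem

variable {d : ℕ}

/-- Multiplication by a matrix, as a continuous linear map. -/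
noncomputable def mulVecCLM (M : Matrix (Fin d) (Fin d) ℝ) : (Fin d → ℝ) →L[ℝ] (Fin d → ℝ) :=
  LinearMap.toContinuousLinearMap M.mulVecLin

@[simp]
lemma mulVecCLM_apply (M : Matrix (Fin d) (Fin d) ℝ) (v : Fin d → ℝ) : mulVecCLM M v = M *ᵥ v := rfl

lemma continuous_mulVecCLM : Continuous (mulVecCLM (d := d)) := by
  let f : Matrix (Fin d) (Fin d) ℝ →ₗ[ℝ] ((Fin d → ℝ) →L[ℝ] (Fin d → ℝ)) :=
    { toFun := mulVecCLM
      map_add' := fun M N => by ext; simp [Matrix.add_mulVec]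
      map_smul' := fun c M => by ext; simp [Matrix.smul_mulVec] }
  exact f.continuous_of_finiteDimensional

/-- `y` solves `y' = B t y` on `[0, ∞)`. -/
def IsLinearSolution (B : ℝ → Matrix (Fin d) (Fin d) ℝ) (y : ℝ → Fin d → ℝ) : Prop :=
  ∀ t ∈ Ici (0 : ℝ), HasDerivWithinAt y (B t *ᵥ y t) (Ici 0) t

/-- A continuous family of matrices with nonnegative entries, bounded by `K`. -/
structure IsNonnegSystem (B : ℝ → Matrix (Fin d) (Fin d) ℝ) (K : ℝ) : Prop where
  continuous : Continuous B
  nonneg : ∀ t i j, 0 ≤ B t i j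
  norm_le : ∀ t, ‖mulVecCLM (B t)‖ ≤ K

variable {B : ℝ → Matrix (Fin d) (Fin d) ℝ} {K : ℝ} {x y : ℝ → Fin d → ℝ}

lemma mulVec_nonneg_of_nonneg {M : Matrix (Fin d) (Fin d) ℝ} (hM : ∀ i j, 0 ≤ M i j)
    {v : Fin d → ℝ} (hv : 0 ≤ v) : 0 ≤ M *ᵥ v :=
  fun i => show 0 ≤ ∑ j, M i j * v j from Finset.sum_nonneg fun j _ => mul_nonneg (hM i j) (hv j)

lemma IsNonnegSystem.shift (hB : IsNonnegSystem B K) (a : ℝ) :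
    IsNonnegSystem (fun t => B (a + t)) K :=
  ⟨hB.continuous.comp (by fun_prop), fun t => hB.nonneg _, fun t => hB.norm_le _⟩

lemma IsLinearSolution.shift (hy : IsLinearSolution B y) {a : ℝ} (ha : 0 ≤ a) :
    IsLinearSolution (fun t => B (a + t)) (fun t => y (a + t)) := by
  intro t (ht : 0 ≤ t)
  have h := (hy (a + t) (add_nonneg ha ht)).scomp t (((hasDerivAt_id t).const_add a).hasDerivWithinAt
    (s := Ici 0)) (fun u (hu : 0 ≤ u) => add_nonneg ha hu)
  rw [one_smul] at h
  exact h

lemma IsLinearSolution.shift_nat (hper : Function.Periodic B 1) (hy : IsLinearSolution B y) (n : ℕ) :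
    IsLinearSolution B (fun t => y (n + t)) := by
  have h := hy.shift n.cast_nonneg
  have : (fun t => B (n + t)) = B := by
    ext1 t
    rw [add_comm]
    simpa using hper.nat_mul n t
  rwa [this] at h

lemma IsLinearSolution.sub (hx : IsLinearSolution B x) (hy : IsLinearSolution B y) :
    IsLinearSolution B (fun t => x t - y t) := fun t ht => by
  rw [Matrix.mulVec_sub]
  exact (hx t ht).sub (hy t ht)

lemma IsLinearSolution.smul (c : ℝ) (hy : IsLinearSolution B y) :
    IsLinearSolution B (fun t => c • y t) := fun t ht => by
  rw [Matrix.mulVec_smul]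
  exact (hy t ht).const_smul c

lemma IsLinearSolution.continuousOn (hy : IsLinearSolution B y) : ContinuousOn y (Ici 0) :=
  fun t ht => (hy t ht).continuousWithinAt

lemma IsLinearSolution.norm_le (hB : IsNonnegSystem B K) (hy : IsLinearSolution B y) {t : ℝ}
    (ht : 0 ≤ t) : ‖y t‖ ≤ ‖y 0‖ * Real.exp (K * t) := by
  have := norm_le_gronwallBound_of_norm_deriv_right_le (f := y) (f' := fun t => B t *ᵥ y t)
    (δ := ‖y 0‖) (K := K) (ε := 0) (a := 0) (b := t) (hy.continuousOn.mono Icc_subset_Ici_self)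
    (fun u hu => (hy u hu.1).mono (Ici_subset_Ici.2 hu.1)) le_rfl
    (fun u _ => by simpa using (mulVecCLM (B u)).le_of_opNorm_le (hB.norm_le u) (y u)) t
    (right_mem_Icc.2 ht)
  simpa [gronwallBound_ε0] using this

lemma IsLinearSolution.eq_of_eq_zero (hB : IsNonnegSystem B K) (hx : IsLinearSolution B x)
    (hy : IsLinearSolution B y) (h0 : x 0 = y 0) {t : ℝ} (ht : 0 ≤ t) : x t = y t := by
  have := (hx.sub hy).norm_le hB ht
  simpa [h0, sub_eq_zero] using this

lemma exists_isLinearSolution_nonneg (hB : IsNonnegSystem B K) {v : Fin d → ℝ} (hv : 0 ≤ v) :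
    ∃ y, IsLinearSolution B y ∧ y 0 = v ∧ ∀ t, 0 ≤ t → 0 ≤ y t := by
  have hL : Continuous (Function.uncurry fun (_ : Unit) t => mulVecCLM (B t)) :=
    continuous_mulVecCLM.comp (hB.continuous.comp continuous_snd)
  have hv' : Continuous fun _ : Unit => v := continuous_const
  refine ⟨picardSum (fun _ t => mulVecCLM (B t)) (fun _ => v) (), fun t _ => ?_, picardSum_zero _,
    fun t ht => ?_⟩
  · exact (hasDerivAt_picardSum hL hv' (fun _ => hB.norm_le) (fun _ => le_rfl) () t).hasDerivWithinAt
  · exact picardSum_nonneg (fun k _ => (continuous_picardTerm hL hv' k).comp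
      (by fun_prop : Continuous fun u : ℝ => ((), u)))
      (fun _ => continuous_mulVecCLM.comp hB.continuous)
      (fun _ t w hw => mulVec_nonneg_of_nonneg (hB.nonneg t) hw) (fun _ => hv) () ht

/-- By uniqueness the solution is the one given by the Picard series, which is nonnegative. -/
lemma IsLinearSolution.nonneg (hB : IsNonnegSystem B K) (hy : IsLinearSolution B y)
    (h0 : 0 ≤ y 0) {t : ℝ} (ht : 0 ≤ t) : 0 ≤ y t := by
  obtain ⟨z, hz, hz0, hz'⟩ := exists_isLinearSolution_nonneg hB h0
  rw [hy.eq_of_eq_zero hB hz hz0.symm ht]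
  exact hz' t ht

lemma monotoneOn_Ici_of_hasDerivWithinAt_nonneg {f f' : ℝ → ℝ} {a : ℝ}
    (hf : ∀ t ∈ Ici a, HasDerivWithinAt f (f' t) (Ici a) t) (hf' : ∀ t ∈ Ici a, 0 ≤ f' t) :
    MonotoneOn f (Ici a) :=
  monotoneOn_of_hasDerivWithinAt_nonneg (convex_Ici a) (fun t ht => (hf t ht).continuousWithinAt)
    (fun t ht => (hf t (interior_subset ht)).mono interior_subset)
    fun t ht => hf' t (interior_subset ht)

lemma IsLinearSolution.monotoneOn (hB : IsNonnegSystem B K) (hy : IsLinearSolution B y)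
    (h0 : 0 ≤ y 0) : MonotoneOn y (Ici 0) := by
  have h : ∀ i, MonotoneOn (fun t => y t i) (Ici 0) := fun i =>
    monotoneOn_Ici_of_hasDerivWithinAt_nonneg (fun t ht => hasDerivWithinAt_pi.1 (hy t ht) i)
      fun t ht => mulVec_nonneg_of_nonneg (hB.nonneg t) (hy.nonneg hB h0 ht) i
  exact fun s hs t ht hst i => h i hs ht hst

lemma IsLinearSolution.sum_pos (hB : IsNonnegSystem B K) (hy : IsLinearSolution B y)
    (h0 : 0 ≤ y 0) (hs : 0 < ∑ i, y 0 i) {t : ℝ} (ht : 0 ≤ t) : 0 < ∑ i, y t i :=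
  hs.trans_le <| Finset.sum_le_sum fun i _ => hy.monotoneOn hB h0 self_mem_Ici ht ht i

/-- Since `y j` is nondecreasing, `y i' ≥ B i j * y j ≥ B i j * y 0 j`; integrate over one period.
-/
lemma IsLinearSolution.integral_mul_le (hB : IsNonnegSystem B K) (hy : IsLinearSolution B y)
    (h0 : 0 ≤ y 0) (i j : Fin d) : (∫ t in (0 : ℝ)..1, B t i j) * y 0 j ≤ y 1 i := by
  have hBij : Continuous fun t => B t i j := hB.continuous.matrix_elem i j
  have hmono : MonotoneOn (fun t => y t i - (∫ u in (0 : ℝ)..t, B u i j) * y 0 j) (Ici 0) := by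
    refine monotoneOn_Ici_of_hasDerivWithinAt_nonneg (fun t ht =>
      (hasDerivWithinAt_pi.1 (hy t ht) i).sub
        ((hBij.integral_hasStrictDerivAt 0 t).hasDerivAt.hasDerivWithinAt.mul_const _))
      fun t ht => sub_nonneg.2 ?_
    calc B t i j * y 0 j ≤ B t i j * y t j :=
          mul_le_mul_of_nonneg_left (hy.monotoneOn hB h0 self_mem_Ici ht ht j) (hB.nonneg t i j)
      _ ≤ ∑ k, B t i k * y t k := Finset.single_le_sum (f := fun k => B t i k * y t k)
          (fun k _ => mul_nonneg (hB.nonneg t i k) (hy.nonneg hB h0 ht k)) (Finset.mem_univ j)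
  have := hmono self_mem_Ici (zero_le_one : (0 : ℝ) ≤ 1) zero_le_one
  simp only [intervalIntegral.integral_same, zero_mul, sub_zero] at this
  have h0i : 0 ≤ y 0 i := h0 i
  linarith

/-! ### Positivity of the solution operator and contraction of ratios -/

/-- The average of `B` over a period is irreducible. -/
def HasIrreducibleAverage (B : ℝ → Matrix (Fin d) (Fin d) ℝ) : Prop :=
  IsIrreducible (Matrix.of fun i j => ∫ t in (0 : ℝ)..1, B t i j)

/-- Each edge of the chain costs one period: mass at `j` reaches `k` after `n` periods, and
`integral_mul_le`, restarted at time `n` by periodicity, carries it along the edge to `i`. -/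
lemma exists_mul_le_of_reflTransGen (hB : IsNonnegSystem B K) (hper : Function.Periodic B 1)
    {i j : Fin d} (hij : Relation.ReflTransGen (fun k l => 0 < ∫ t in (0 : ℝ)..1, B t k l) i j) :
    ∃ n : ℕ, ∃ α > 0, ∀ y, IsLinearSolution B y → 0 ≤ y 0 → α * y 0 j ≤ y n i := by
  induction hij using Relation.ReflTransGen.head_induction_on with
  | refl => exact ⟨0, 1, one_pos, fun y _ _ => by simp⟩
  | @head i k hik _ ih =>
    obtain ⟨n, α, hα, h⟩ := ih
    refine ⟨n + 1, _, mul_pos hik hα, fun y hy h0 => ?_⟩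
    have h1 := (hy.shift_nat hper n).integral_mul_le hB
      (by simpa using hy.nonneg hB h0 n.cast_nonneg) i k
    rw [add_zero] at h1
    push_cast
    refine le_trans ?_ h1
    rw [mul_assoc]
    exact mul_le_mul_of_nonneg_left (h y hy h0) hik.le

/-- After sufficiently many periods, the solution operator has positive entries. -/
lemma exists_uniform_lower_bound (hB : IsNonnegSystem B K) (hper : Function.Periodic B 1)
    (hirr : HasIrreducibleAverage B) :
    ∃ N : ℕ, 0 < N ∧ ∃ α > 0, ∀ y, IsLinearSolution B y → 0 ≤ y 0 →
      ∀ i, α * ∑ j, y 0 j ≤ y N i := by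
  choose n α hα h using fun i j => exists_mul_le_of_reflTransGen hB hper (hirr i j)
  -- By monotonicity in time, the bounds for the finitely many pairs `(i, j)` all persist up to a
  -- common `N`.
  have h1 : ∀ᶠ N in atTop, ∀ i j, n i j ≤ N :=
    eventually_all.2 fun i => eventually_all.2 fun j => eventually_ge_atTop _
  have h2 : ∀ᶠ a in 𝓝[>] (0 : ℝ), ∀ i j, a ≤ α i j :=
    eventually_all.2 fun i => eventually_all.2 fun j =>
      eventually_nhdsWithin_of_eventually_nhds (eventually_le_nhds (hα i j))
  obtain ⟨N, hN, hN0⟩ := (h1.and (eventually_gt_atTop 0)).exists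
  obtain ⟨a, ha, ha0 : 0 < a⟩ := (h2.and self_mem_nhdsWithin).exists
  -- Summing `a * y 0 j ≤ y N i` over `j` costs a factor `d`; `d + 1` keeps the denominator positive
  -- even for `d = 0`.
  refine ⟨N, hN0, a / (d + 1), by positivity, fun y hy h0 i => ?_⟩
  have hyN := hy.nonneg hB h0 N.cast_nonneg i
  have hle : ∀ j, a * y 0 j ≤ y N i := fun j =>
    calc a * y 0 j ≤ α i j * y 0 j := mul_le_mul_of_nonneg_right (ha i j) (h0 j)
      _ ≤ y (n i j) i := h i j y hy h0
      _ ≤ y N i := hy.monotoneOn hB h0 (mem_Ici.2 (n i j).cast_nonneg) (mem_Ici.2 N.cast_nonneg)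
          (Nat.cast_le.2 (hN i j)) i
  have hsum : a * ∑ j, y 0 j ≤ d * y N i := by
    rw [Finset.mul_sum]
    simpa using Finset.sum_le_sum fun j (_ : j ∈ Finset.univ) => hle j
  rw [div_mul_eq_mul_div, div_le_iff₀ (by positivity)]
  simp only [Pi.zero_apply] at hyN
  linarith

lemma IsLinearSolution.apply_le (hB : IsNonnegSystem B K) (hy : IsLinearSolution B y)
    (h0 : 0 ≤ y 0) {t : ℝ} (ht : 0 ≤ t) (i : Fin d) :
    y t i ≤ Real.exp (K * t) * ∑ j, y 0 j := by
  have h1 : ‖y 0‖ ≤ ∑ j, y 0 j := by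
    refine (pi_norm_le_iff_of_nonneg (Finset.sum_nonneg fun j _ => h0 j)).2 fun j => ?_
    rw [Real.norm_of_nonneg (h0 j)]
    exact Finset.single_le_sum (f := fun j => y 0 j) (fun k _ => h0 k) (Finset.mem_univ j)
  calc y t i ≤ ‖y t‖ := (le_abs_self _).trans (norm_le_pi_norm (y t) i)
    _ ≤ ‖y 0‖ * Real.exp (K * t) := hy.norm_le hB ht
    _ ≤ Real.exp (K * t) * ∑ j, y 0 j := by rw [mul_comm]; gcongr

/-- If a positive solution operator has entries between `α` and `β`, the oscillation of the ratios
of two solutions is contracted by the factor `1 - α / β`. -/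
lemma oscillation_contraction {t α β m M : ℝ} (hα : 0 < α) (hβ : 0 < β)
    (hlow : ∀ y, IsLinearSolution B y → 0 ≤ y 0 → ∀ i, α * ∑ j, y 0 j ≤ y t i)
    (hup : ∀ i, y t i ≤ β * ∑ j, y 0 j)
    (hx : IsLinearSolution B x) (hy : IsLinearSolution B y) (hs : 0 < ∑ j, y 0 j)
    (hm : m • y 0 ≤ x 0) (hM : x 0 ≤ M • y 0) :
    ∃ m' M', m ≤ m' ∧ M' - m' ≤ (1 - α / β) * (M - m) ∧ m' • y t ≤ x t ∧ x t ≤ M' • y t := by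
  -- The lower bound is applied to the nonnegative solutions `x - m • y` and `M • y - x`.
  have hz := hlow _ (hx.sub (hy.smul m)) (sub_nonneg.2 hm)
  have hw := hlow _ ((hy.smul M).sub hx) (sub_nonneg.2 hM)
  simp only [Pi.sub_apply, Pi.smul_apply, smul_eq_mul, Finset.sum_sub_distrib,
    ← Finset.mul_sum] at hz hw
  set X := ∑ j, x 0 j
  set Y := ∑ j, y 0 j
  have hmX : m * Y ≤ X := by
    rw [Finset.mul_sum]; exact Finset.sum_le_sum fun j _ => hm j
  have hMX : X ≤ M * Y := by
    rw [Finset.mul_sum]; exact Finset.sum_le_sum fun j _ => hM j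
  have key : ∀ c, 0 ≤ c → ∀ i, α * c / (β * Y) * y t i ≤ α * c := fun c hc i =>
    calc α * c / (β * Y) * y t i ≤ α * c / (β * Y) * (β * Y) :=
          mul_le_mul_of_nonneg_left (hup i) (by positivity)
      _ = α * c := by field_simp
  -- At time `t` the solution `x - m • y` is at least `α * (X - m * Y)`, while `y` is at most `β *
  -- Y`; the quotient is the gain in `m`, and likewise for `M`. The two gains add up to `α / β * (M
  -- - m)`, whatever `X` is.
  refine ⟨m + α * (X - m * Y) / (β * Y), M - α * (M * Y - X) / (β * Y),
    le_add_of_nonneg_right (div_nonneg (mul_nonneg hα.le (sub_nonneg.2 hmX)) (by positivity)),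
    le_of_eq (by field_simp; ring), fun i => ?_, fun i => ?_⟩
  · have := key _ (sub_nonneg.2 hmX) i
    have := hz i
    simp only [Pi.smul_apply, smul_eq_mul]
    linarith
  · have := key _ (sub_nonneg.2 hMX) i
    have := hw i
    simp only [Pi.smul_apply, smul_eq_mul]
    linarith

/-- Bounds on the ratios of two solutions are preserved by the evolution. -/
lemma IsLinearSolution.smul_le (hB : IsNonnegSystem B K) (hx : IsLinearSolution B x)
    (hy : IsLinearSolution B y) {a b s t : ℝ} (hs : 0 ≤ s) (hst : s ≤ t) (h : a • y s ≤ b • x s) :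
    a • y t ≤ b • x t := by
  have := (((hx.smul b).sub (hy.smul a)).shift hs).nonneg (hB.shift s) (t := t - s)
    (by simpa using h) (sub_nonneg.2 hst)
  simpa using this

/-- The lower bound `m` is fixed before `ε`, so that the error can later be measured relative to it.
-/
lemma oscillation_tendsto_zero (hB : IsNonnegSystem B K) (hper : Function.Periodic B 1)
    (hirr : HasIrreducibleAverage B) (hx : IsLinearSolution B x) (hy : IsLinearSolution B y)
    (hx0 : 0 ≤ x 0) (hy0 : 0 ≤ y 0) (hxs : 0 < ∑ j, x 0 j) (hys : 0 < ∑ j, y 0 j) :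
    ∃ m > (0 : ℝ), ∀ ε > (0 : ℝ), ∃ T ≥ (0 : ℝ), ∃ m' M' : ℝ, m ≤ m' ∧ M' - m' ≤ ε ∧
      ∀ t ≥ T, m' • y t ≤ x t ∧ x t ≤ M' • y t := by
  obtain ⟨N, hN, α, hα, hlow⟩ := exists_uniform_lower_bound hB hper hirr
  -- The maximum with `α` ensures `α / β ≤ 1`.
  set β := max α (Real.exp (K * N)) with hβ_def
  have hβ : 0 < β := lt_max_of_lt_left hα
  have hαβ : α / β ≤ 1 := (div_le_one hβ).2 (le_max_left _ _)
  have hup : ∀ y, IsLinearSolution B y → 0 ≤ y 0 → ∀ i, y N i ≤ β * ∑ j, y 0 j :=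
    fun y hy h0 i => (hy.apply_le hB h0 N.cast_nonneg i).trans
      (mul_le_mul_of_nonneg_right (le_max_right _ _) (Finset.sum_nonneg fun j _ => h0 j))
  have hxN : ∀ i, 0 < x N i := fun i => (mul_pos hα hxs).trans_le (hlow x hx hx0 i)
  have hyN : ∀ i, 0 < y N i := fun i => (mul_pos hα hys).trans_le (hlow y hy hy0 i)
  -- The initial vectors may have zero coordinates; at time `N` all are positive and the ratios make
  -- sense. Hence the iteration runs over times `(k + 1) * N`.
  obtain ⟨m, hm, hm0 : 0 < m⟩ : ∃ m : ℝ, (∀ i, m * y N i ≤ x N i) ∧ 0 < m := by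
    have : ∀ᶠ m in 𝓝[>] (0 : ℝ), ∀ i, m ≤ x N i / y N i := eventually_all.2 fun i =>
      eventually_nhdsWithin_of_eventually_nhds (eventually_le_nhds (div_pos (hxN i) (hyN i)))
    obtain ⟨m, hm, hm0⟩ := (this.and self_mem_nhdsWithin).exists
    exact ⟨m, fun i => (le_div_iff₀ (hyN i)).1 (hm i), hm0⟩
  obtain ⟨M, hM⟩ : ∃ M : ℝ, ∀ i, x N i ≤ M * y N i := by
    have : ∀ᶠ M in atTop, ∀ i, x N i / y N i ≤ M := eventually_all.2 fun i => eventually_ge_atTop _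
    obtain ⟨M, hM⟩ := this.exists
    exact ⟨M, fun i => (div_le_iff₀ (hyN i)).1 (hM i)⟩
  have hiter : ∀ k : ℕ, ∃ m' M', m ≤ m' ∧ M' - m' ≤ (1 - α / β) ^ k * (M - m) ∧
      m' • y ((k + 1) * N : ℕ) ≤ x ((k + 1) * N : ℕ) ∧
      x ((k + 1) * N : ℕ) ≤ M' • y ((k + 1) * N : ℕ) := by
    intro k
    induction k with
    | zero => exact ⟨m, M, le_rfl, by simp, fun i => by simpa using hm i, fun i => by simpa using hM i⟩
    | succ k ih =>
      obtain ⟨m₁, M₁, h1, h2, h3, h4⟩ := ih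
      have hyk := hy.shift_nat hper ((k + 1) * N)
      have hyk0 := hy.nonneg hB hy0 ((k + 1) * N : ℕ).cast_nonneg
      obtain ⟨m', M', h5, h6, h7, h8⟩ := oscillation_contraction (t := N) hα hβ hlow
        (hup _ hyk (by simpa using hyk0)) (hx.shift_nat hper ((k + 1) * N)) hyk
        (by simpa using hy.sum_pos hB hy0 hys ((k + 1) * N : ℕ).cast_nonneg)
        (by simpa using h3) (by simpa using h4)
      have e : (((k + 1) * N : ℕ) + N : ℝ) = ((k + 1 + 1) * N : ℕ) := by push_cast; ring
      rw [e] at h7 h8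
      refine ⟨m', M', h1.trans h5, h6.trans ?_, h7, h8⟩
      rw [pow_succ', mul_assoc]
      exact mul_le_mul_of_nonneg_left h2 (sub_nonneg.2 hαβ)
  refine ⟨m, hm0, fun ε hε => ?_⟩
  have hlim : Tendsto (fun k : ℕ => (1 - α / β) ^ k * (M - m)) atTop (𝓝 (0 * (M - m))) :=
    (tendsto_pow_atTop_nhds_zero_of_lt_one (sub_nonneg.2 hαβ)
      (sub_lt_self _ (div_pos hα hβ))).mul_const _
  rw [zero_mul] at hlim
  obtain ⟨k, hk⟩ := (hlim.eventually_lt_const hε).exists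
  obtain ⟨m', M', h1, h2, h3, h4⟩ := hiter k
  refine ⟨((k + 1) * N : ℕ), Nat.cast_nonneg _, m', M', h1, h2.trans hk.le, fun t ht => ⟨?_, ?_⟩⟩
  · simpa using hx.smul_le hB hy (Nat.cast_nonneg _) ht (a := m') (b := 1) (by simpa using h3)
  · simpa using hy.smul_le hB hx (Nat.cast_nonneg _) ht (a := 1) (b := M') (by simpa using h4)

/-- Two nonnegative solutions become proportional. -/
lemma tendsto_normalized_sub_normalized (hB : IsNonnegSystem B K) (hper : Function.Periodic B 1)
    (hirr : HasIrreducibleAverage B) (hx : IsLinearSolution B x) (hy : IsLinearSolution B y)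
    (hx0 : 0 ≤ x 0) (hy0 : 0 ≤ y 0) (hxs : 0 < ∑ j, x 0 j) (hys : 0 < ∑ j, y 0 j) :
    Tendsto (fun t => (∑ j, x t j)⁻¹ • x t - (∑ j, y t j)⁻¹ • y t) atTop (𝓝 0) := by
  obtain ⟨m, hm, h⟩ := oscillation_tendsto_zero hB hper hirr hx hy hx0 hy0 hxs hys
  refine tendsto_pi_nhds.2 fun i => Metric.tendsto_atTop.2 fun ε hε => ?_
  -- The normalized vectors differ by at most `(M' - m') * Y / X` per coordinate, and `m * Y ≤ X`.
  obtain ⟨T, hT, m', M', h1, h2, h3⟩ := h (m * ε / 2) (by positivity)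
  refine ⟨T, fun t ht => ?_⟩
  have ht0 : 0 ≤ t := hT.trans ht
  have hX := hx.sum_pos hB hx0 hxs ht0
  have hY := hy.sum_pos hB hy0 hys ht0
  have hyi : 0 ≤ y t i := hy.nonneg hB hy0 ht0 i
  have hyY : y t i ≤ ∑ j, y t j := Finset.single_le_sum (f := fun j => y t j)
    (fun k _ => hy.nonneg hB hy0 ht0 k) (Finset.mem_univ i)
  obtain ⟨hlow, hup⟩ := h3 t ht
  have hmX : m' * ∑ j, y t j ≤ ∑ j, x t j := by
    rw [Finset.mul_sum]; exact Finset.sum_le_sum fun j _ => hlow j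
  have hMX : ∑ j, x t j ≤ M' * ∑ j, y t j := by
    rw [Finset.mul_sum]; exact Finset.sum_le_sum fun j _ => hup j
  have hli : m' * y t i ≤ x t i := hlow i
  have hui : x t i ≤ M' * y t i := hup i
  set X := ∑ j, x t j
  set Y := ∑ j, y t j
  -- Both `x t i * Y` and `y t i * X` lie between `m' * y t i * Y` and `M' * y t i * Y`.
  have hkey : |x t i * Y - y t i * X| ≤ (M' - m') * y t i * Y := by
    rw [abs_le]
    constructor <;> nlinarith
  have hMm : 0 ≤ M' - m' := by
    have : m' * Y ≤ M' * Y := hmX.trans hMX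
    linarith [le_of_mul_le_mul_right this hY]
  have hmYX : m * Y ≤ X := (mul_le_mul_of_nonneg_right h1 hY.le).trans hmX
  rw [Real.dist_eq]
  have e : (X⁻¹ • x t - Y⁻¹ • y t) i - (0 : Fin d → ℝ) i = (x t i * Y - y t i * X) / (X * Y) := by
    simp only [Pi.sub_apply, Pi.smul_apply, smul_eq_mul, Pi.zero_apply]
    field_simp
    ring
  rw [e, abs_div, abs_of_pos (mul_pos hX hY), div_lt_iff₀ (mul_pos hX hY)]
  calc _ ≤ (M' - m') * y t i * Y := hkey
    _ ≤ (m * ε / 2) * Y * Y := by gcongr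
    _ = ε / 2 * ((m * Y) * Y) := by ring
    _ ≤ ε / 2 * (X * Y) := by gcongr
    _ < ε * (X * Y) := by nlinarith [mul_pos hX hY]

end NonnegSystem

/-! ### Correspondence between linear solutions and solutions in the simplex -/

section Simplex

variable {d : ℕ}

lemma simplex_nonneg (θ : Simplex d) : 0 ≤ (θ : Fin d → ℝ) := θ.2.1

lemma simplex_sum_pos (θ : Simplex d) : 0 < ∑ i, θ i := by
  rw [stdSimplex.sum_eq_one]; exact one_pos

/-- The family `A + c • 1`. -/
noncomputable def addDiag {S : Type*} (A : S → Matrix (Fin d) (Fin d) ℝ) (c : ℝ) (s : S) :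
    Matrix (Fin d) (Fin d) ℝ :=
  A s + c • (1 : Matrix (Fin d) (Fin d) ℝ)

lemma dotProduct_one_eq_sum (v : Fin d → ℝ) : v ⬝ᵥ 1 = ∑ i, v i := by
  simp [dotProduct]

/-- Adding a multiple of the identity to `A` does not change the vector field on the simplex. -/
lemma simplexField_add_smul_one {S : Type*} (A : S → Matrix (Fin d) (Fin d) ℝ) (c : ℝ) :
    simplexField (addDiag A c) = simplexField A := by
  funext s θ
  simp only [simplexField, growthRate, addDiag, Matrix.add_mulVec, Matrix.smul_mulVec, Matrix.one_mulVec,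
    add_dotProduct, smul_dotProduct, dotProduct_one_eq_sum θ, stdSimplex.sum_eq_one]
  module

lemma isSimplexSolution_add_smul_one {S : Type*} (A : S → Matrix (Fin d) (Fin d) ℝ) (c : ℝ) :
    IsSimplexSolution (addDiag A c) = IsSimplexSolution A := by
  unfold IsSimplexSolution
  rw [simplexField_add_smul_one]

lemma simplexField_eq_of_smul {S : Type*} (B : S → Matrix (Fin d) (Fin d) ℝ) (s : S)
    (θ : Simplex d) {y : Fin d → ℝ} {c : ℝ} (h : (θ : Fin d → ℝ) = c • y) :
    simplexField B s θ = c • (B s *ᵥ y) - (c * ∑ i, (B s *ᵥ y) i) • (θ : Fin d → ℝ) := by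
  simp only [simplexField, growthRate, h, Matrix.mulVec_smul, smul_dotProduct,
    dotProduct_one_eq_sum, smul_eq_mul]

/-- The direction of a nonnegative linear solution solves the equation in the simplex. -/
lemma exists_isSimplexSolution_of_isLinearSolution {S : Type*} {B : S → Matrix (Fin d) (Fin d) ℝ}
    {ω : ℝ → S} {K : ℝ} (hB : IsNonnegSystem (fun t => B (ω t)) K) {y : ℝ → Fin d → ℝ}
    (hy : IsLinearSolution (fun t => B (ω t)) y) (h0 : 0 ≤ y 0) (hs : 0 < ∑ i, y 0 i) :
    ∃ θ : ℝ → Simplex d, IsSimplexSolution B ω (Ici 0) θ ∧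
      ∀ t, 0 ≤ t → (θ t : Fin d → ℝ) = (∑ i, y t i)⁻¹ • y t := by
  have hpos : ∀ t, 0 ≤ t → 0 < ∑ i, y t i := fun t ht => hy.sum_pos hB h0 hs ht
  have hmem : ∀ t, 0 ≤ t → (∑ i, y t i)⁻¹ • y t ∈ stdSimplex ℝ (Fin d) := fun t ht =>
    ⟨fun i => mul_nonneg (inv_nonneg.2 (hpos t ht).le) (hy.nonneg hB h0 ht i), by
      simp only [Pi.smul_apply, smul_eq_mul, ← Finset.mul_sum]
      exact inv_mul_cancel₀ (hpos t ht).ne'⟩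
  -- Truncating at `0` keeps the values in the simplex at negative times, where `y` is uncontrolled.
  let θ : ℝ → Simplex d := fun t =>
    ⟨(∑ i, y (max t 0) i)⁻¹ • y (max t 0), hmem _ (le_max_right _ _)⟩
  have hθ : ∀ t, 0 ≤ t → (θ t : Fin d → ℝ) = (∑ i, y t i)⁻¹ • y t := fun t ht => by
    simp only [θ, max_eq_left ht]
    rfl
  refine ⟨θ, fun t ht => ?_, hθ⟩
  have hS : HasDerivWithinAt (fun u => ∑ i, y u i) (∑ i, (B (ω t) *ᵥ y t) i) (Ici 0) t :=
    HasDerivWithinAt.fun_sum fun i _ => hasDerivWithinAt_pi.1 (hy t ht) i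
  have hd := (hS.fun_inv (hpos t ht).ne').fun_smul (hy t ht)
  have hd' := hd.congr (f₁ := fun u => (θ u : Fin d → ℝ)) (fun u hu => hθ u hu) (hθ t ht)
  rw [simplexField_eq_of_smul B (ω t) (θ t) (hθ t ht), hθ t ht]
  convert! hd' using 1
  rw [smul_smul, sub_eq_add_neg, ← neg_smul]
  congr 2
  field_simp

/-- Every solution in the simplex is the direction of a nonnegative linear solution. -/
lemma exists_isLinearSolution_of_isSimplexSolution {S : Type*} {B : S → Matrix (Fin d) (Fin d) ℝ}
    {ω : ℝ → S} (hB : Continuous fun t => B (ω t)) {θ : ℝ → Simplex d}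
    (hθ : IsSimplexSolution B ω (Ici 0) θ) :
    ∃ y : ℝ → Fin d → ℝ, IsLinearSolution (fun t => B (ω t)) y ∧ y 0 = θ 0 ∧
      ∀ t, (θ t : Fin d → ℝ) = (∑ i, y t i)⁻¹ • y t := by
  have hc : ContinuousOn (fun t => (θ t : Fin d → ℝ)) (Ici 0) :=
    fun t ht => (hθ t ht).continuousWithinAt
  have hm : Continuous fun t : ℝ => max t 0 := by fun_prop
  have hc' : Continuous fun t => (θ (max t 0) : Fin d → ℝ) :=
    hc.comp_continuous hm fun t => mem_Ici.2 (le_max_right _ _)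
  have hg : Continuous fun t => growthRate B (ω (max t 0)) (θ (max t 0)) := by
    unfold growthRate
    exact ((hB.comp hm).matrix_mulVec hc').dotProduct continuous_const
  -- This factor restores the total mass: `r' = growthRate * r` cancels the normalizing term of the
  -- field in `(r • θ)'`.
  let r : ℝ → ℝ := fun t => Real.exp (∫ u in (0 : ℝ)..t, growthRate B (ω (max u 0)) (θ (max u 0)))
  refine ⟨fun t => r t • (θ t : Fin d → ℝ), fun t (ht : 0 ≤ t) => ?_, by simp [r], fun t => ?_⟩
  · have hr : HasDerivWithinAt r (r t * growthRate B (ω t) (θ t)) (Ici 0) t := by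
      have := (hg.integral_hasStrictDerivAt 0 t).hasDerivAt.exp.hasDerivWithinAt (s := Ici 0)
      rwa [max_eq_left ht] at this
    convert! hr.fun_smul (hθ t ht) using 1
    simp only [simplexField, Matrix.mulVec_smul]
    module
  · have h1 : ∑ i, (r t • (θ t : Fin d → ℝ)) i = r t := by
      simp only [Pi.smul_apply, smul_eq_mul, ← Finset.mul_sum]
      rw [stdSimplex.sum_eq_one, mul_one]
    rw [h1, smul_smul, inv_mul_cancel₀ (Real.exp_pos _).ne', one_smul]

end Simplex

/-! ### Periodic driving: well-posedness, merging and continuity of the flow -/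

section Rotation

variable {d : ℕ} {A : UnitAddCircle → Matrix (Fin d) (Fin d) ℝ}

lemma continuous_rotationPath : Continuous (Function.uncurry rotationPath) := by
  unfold rotationPath Function.uncurry
  have : Continuous ((↑) : ℝ → UnitAddCircle) := AddCircle.continuous_mk' 1
  fun_prop

lemma rotationPath_add_one (s : UnitAddCircle) (t : ℝ) :
    rotationPath s (t + 1) = rotationPath s t := by
  simp [rotationPath]

lemma rotationPath_coe (s t : ℝ) : rotationPath (s : UnitAddCircle) t = ((s + t : ℝ) : UnitAddCircle) := by
  simp [rotationPath]

/-- A Metzler family becomes a family of nonnegative systems after adding a multiple of `1`. -/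
lemma exists_isNonnegSystem (hA : Continuous A) (hM : ∀ s, IsMetzler (A s)) :
    ∃ c K : ℝ, 0 ≤ c ∧ ∀ s, IsNonnegSystem
      (fun t => addDiag A c (rotationPath s t)) K := by
  obtain ⟨c, hc⟩ : ∃ c : ℝ, ∀ s i, -c ≤ A s i i := by
    have h : ∀ i, ∃ b : ℝ, ∀ s, b ≤ A s i i := fun i => by
      obtain ⟨s, hs⟩ := (hA.matrix_elem i i).exists_forall_le_of_hasCompactSupport
        (HasCompactSupport.of_compactSpace _)
      exact ⟨_, hs⟩
    choose b hb using h
    have : ∀ᶠ c in atTop, ∀ i, -b i ≤ c := eventually_all.2 fun i => eventually_ge_atTop _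
    obtain ⟨c, hc⟩ := this.exists
    exact ⟨c, fun s i => (neg_le.1 (hc i)).trans (hb i s)⟩
  have hcont : Continuous (addDiag A (max c 0)) := by unfold addDiag; fun_prop
  obtain ⟨K, hK⟩ := (isCompact_range (continuous_mulVecCLM.comp hcont)).isBounded.exists_norm_le
  refine ⟨max c 0, K, le_max_right _ _, fun s => ⟨?_, fun t i j => ?_, fun t => hK _ ⟨_, rfl⟩⟩⟩
  · exact hcont.comp (continuous_rotationPath.comp (by fun_prop : Continuous fun t : ℝ => (s, t)))
  · by_cases hij : i = j
    · subst hij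
      have := hc (rotationPath s t) i
      have := le_max_left c 0
      simp only [addDiag, Matrix.add_apply, Matrix.smul_apply, Matrix.one_apply_eq, smul_eq_mul, mul_one]
      linarith
    · simpa [addDiag, Matrix.one_apply_ne hij] using hM (rotationPath s t) i j hij

/-- The starting phase is irrelevant by translation invariance, and `c ≥ 0` can only increase the
averaged entries. -/
lemma hasIrreducibleAverage_rotationPath (hA : Continuous A)
    (hirr : IsIrreducible (averageMatrix A (volume : Measure UnitAddCircle))) {c : ℝ} (hc : 0 ≤ c)
    (s : UnitAddCircle) : HasIrreducibleAverage
      (fun t => addDiag A c (rotationPath s t)) := by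
  intro i j
  refine Relation.ReflTransGen.mono (fun k l hkl => ?_) _ _ (hirr i j)
  have hAkl : Continuous fun u => A u k l := hA.matrix_elem k l
  have h1 : ∫ t in (0 : ℝ)..1, A (rotationPath s t) k l = ∫ u, A u k l := by
    have := UnitAddCircle.intervalIntegral_preimage 0 (fun u => A (s + u) k l)
    rw [zero_add] at this
    rw [← integral_add_left_eq_self (fun u => A u k l) s]
    exact this
  have h2 : Continuous fun t => A (rotationPath s t) k l :=
    hAkl.comp (continuous_rotationPath.comp (by fun_prop : Continuous fun t : ℝ => (s, t)))
  have hkl' : 0 < ∫ u, A u k l := hkl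
  simp only [addDiag, Matrix.of_apply, Matrix.add_apply, Matrix.smul_apply]
  rw [intervalIntegral.integral_add (h2.intervalIntegrable _ _) intervalIntegrable_const, h1]
  refine add_pos_of_pos_of_nonneg hkl' ?_
  have : 0 ≤ (1 : Matrix (Fin d) (Fin d) ℝ) k l := by
    rw [Matrix.one_apply]; split_ifs <;> norm_num
  simpa using mul_nonneg hc this

lemma wellPosed (hA : Continuous A) (hM : ∀ s, IsMetzler (A s)) : WellPosed A := by
  obtain ⟨c, K, -, hB⟩ := exists_isNonnegSystem hA hM
  intro s θ₀
  rw [← isSimplexSolution_add_smul_one A c]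
  constructor
  · obtain ⟨y, hy, hy0, -⟩ := exists_isLinearSolution_nonneg (hB s) (simplex_nonneg θ₀)
    have hs : 0 < ∑ i, y 0 i := by rw [hy0]; exact simplex_sum_pos θ₀
    obtain ⟨θ, hθ, hθy⟩ := exists_isSimplexSolution_of_isLinearSolution (hB s) hy
      (hy0 ▸ (simplex_nonneg θ₀)) hs
    refine ⟨θ, hθ, stdSimplex.ext ?_⟩
    rw [hθy 0 le_rfl, hy0, stdSimplex.sum_eq_one, inv_one, one_smul]
  · intro θ θ' hθ h0 hθ' h0' t ht
    obtain ⟨y, hy, hy0, hyθ⟩ := exists_isLinearSolution_of_isSimplexSolution (hB s).continuous hθ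
    obtain ⟨y', hy', hy0', hyθ'⟩ :=
      exists_isLinearSolution_of_isSimplexSolution (hB s).continuous hθ'
    have := hy.eq_of_eq_zero (hB s) hy' (by rw [hy0, hy0', h0, h0']) ht
    exact stdSimplex.ext (by rw [hyθ, hyθ', this])

/-- Any two solutions in the simplex with the same driving path converge together. -/
lemma tendsto_sub_of_isSimplexSolution (hA : Continuous A) (hM : ∀ s, IsMetzler (A s))
    (hirr : IsIrreducible (averageMatrix A (volume : Measure UnitAddCircle)))
    {s : UnitAddCircle} {θ θ' : ℝ → Simplex d}
    (hθ : IsSimplexSolution A (rotationPath s) (Ici 0) θ)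
    (hθ' : IsSimplexSolution A (rotationPath s) (Ici 0) θ') :
    Tendsto (fun t => (θ t : Fin d → ℝ) - (θ' t : Fin d → ℝ)) atTop (𝓝 0) := by
  obtain ⟨c, K, hc, hB⟩ := exists_isNonnegSystem hA hM
  rw [← isSimplexSolution_add_smul_one A c] at hθ hθ'
  obtain ⟨y, hy, hy0, hyθ⟩ := exists_isLinearSolution_of_isSimplexSolution (hB s).continuous hθ
  obtain ⟨y', hy', hy0', hyθ'⟩ :=
    exists_isLinearSolution_of_isSimplexSolution (hB s).continuous hθ'
  simp only [hyθ, hyθ']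
  exact tendsto_normalized_sub_normalized (hB s)
    (fun t => by simp only [rotationPath_add_one]) (hasIrreducibleAverage_rotationPath hA hirr hc s) hy hy'
    (hy0 ▸ simplex_nonneg _) (hy0' ▸ simplex_nonneg _) (hy0 ▸ simplex_sum_pos _) (hy0' ▸ simplex_sum_pos _)

lemma isSimplexSolution_simplexFlow (hwp : WellPosed A) (s : UnitAddCircle) (θ₀ : Simplex d) :
    IsSimplexSolution A (rotationPath s) (Ici 0) (simplexFlow A s θ₀) ∧ simplexFlow A s θ₀ 0 = θ₀ := by
  have h := (hwp s θ₀).1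
  have e : simplexFlow A s θ₀ = h.choose := by
    funext t
    exact dif_pos h
  rw [e]
  exact h.choose_spec

lemma simplexFlow_eq (hwp : WellPosed A) {s : UnitAddCircle} {θ : ℝ → Simplex d}
    (hθ : IsSimplexSolution A (rotationPath s) (Ici 0) θ) {t : ℝ} (ht : 0 ≤ t) :
    simplexFlow A s (θ 0) t = θ t :=
  have h := isSimplexSolution_simplexFlow hwp s (θ 0)
  (hwp s (θ 0)).2 _ _ h.1 h.2 hθ rfl ht

/-- The flow at a fixed time is jointly continuous in the phase and the initial condition. -/
lemma continuous_simplexFlow (hA : Continuous A) (hM : ∀ s, IsMetzler (A s)) {t : ℝ} (ht : 0 ≤ t) :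
    Continuous fun p : UnitAddCircle × Simplex d => simplexFlow A p.1 p.2 t := by
  have hwp := wellPosed hA hM
  obtain ⟨c, K, -, hB⟩ := exists_isNonnegSystem hA hM
  -- Phase and initial condition together form the parameter of the Picard series, whose continuity
  -- in the parameter gives that of the flow.
  let L : UnitAddCircle × Simplex d → ℝ → (Fin d → ℝ) →L[ℝ] (Fin d → ℝ) := fun p t =>
    mulVecCLM (addDiag A c (rotationPath p.1 t))
  let v : UnitAddCircle × Simplex d → Fin d → ℝ := fun p => p.2
  have hv : Continuous v := continuous_subtype_val.comp continuous_snd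
  have hL : Continuous (Function.uncurry L) := by
    refine continuous_mulVecCLM.comp (Continuous.add (hA.comp ?_) continuous_const)
    exact continuous_rotationPath.comp
      (by fun_prop : Continuous fun q : (UnitAddCircle × Simplex d) × ℝ => (q.1.1, q.2))
  have hLK : ∀ p t, ‖L p t‖ ≤ K := fun p t => (hB p.1).norm_le t
  have hv1 : ∀ p, ‖v p‖ ≤ 1 := fun p =>
    (pi_norm_le_iff_of_nonneg zero_le_one).2 fun i => by
      rw [Real.norm_of_nonneg (simplex_nonneg p.2 i)]
      exact stdSimplex.le_one p.2 i
  have hy : ∀ p, IsLinearSolution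
      (fun t => addDiag A c (rotationPath p.1 t)) (picardSum L v p) :=
    fun p t _ => (hasDerivAt_picardSum hL hv hLK hv1 p t).hasDerivWithinAt
  have hy0 : ∀ p, picardSum L v p 0 = p.2 := fun p => picardSum_zero p
  have hcont := continuous_picardSum hL hv hLK hv1 t
  have hpos : ∀ p, 0 < ∑ i, picardSum L v p t i := fun p =>
    (hy p).sum_pos (hB p.1) (hy0 p ▸ simplex_nonneg _) (hy0 p ▸ simplex_sum_pos _) ht
  have e : ∀ p, (simplexFlow A p.1 p.2 t : Fin d → ℝ)
      = (∑ i, picardSum L v p t i)⁻¹ • picardSum L v p t := by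
    intro p
    obtain ⟨θ, hθ, hθy⟩ := exists_isSimplexSolution_of_isLinearSolution (hB p.1) (hy p)
      (hy0 p ▸ simplex_nonneg _) (hy0 p ▸ simplex_sum_pos _)
    rw [isSimplexSolution_add_smul_one A c] at hθ
    have h0 : θ 0 = p.2 := stdSimplex.ext <| by
      rw [hθy 0 le_rfl, hy0, stdSimplex.sum_eq_one, inv_one, one_smul]
    rw [← hθy t ht, ← simplexFlow_eq hwp hθ ht, h0]
  have hc : Continuous fun p : UnitAddCircle × Simplex d => (simplexFlow A p.1 p.2 t : Fin d → ℝ) := by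
    simp only [e]
    refine Continuous.smul (Continuous.inv₀ ?_ fun p => (hpos p).ne') hcont
    exact continuous_finsetSum _ fun i _ => (continuous_apply i).comp hcont
  exact continuous_induced_rng.2 hc

end Rotation

/-! ### The periodic solution -/

section PeriodicSolution

variable {d : ℕ} {A : UnitAddCircle → Matrix (Fin d) (Fin d) ℝ}

lemma IsSimplexSolution.shift {s : UnitAddCircle} {θ : ℝ → Simplex d}
    (hθ : IsSimplexSolution A (rotationPath s) (Ici 0) θ) {a : ℝ} (ha : 0 ≤ a) :
    IsSimplexSolution A (rotationPath (s + a)) (Ici 0) (fun t => θ (a + t)) := by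
  intro t (ht : 0 ≤ t)
  have h := (hθ (a + t) (add_nonneg ha ht)).scomp t
    (((hasDerivAt_id t).const_add a).hasDerivWithinAt (s := Ici 0))
    (fun u (hu : 0 ≤ u) => add_nonneg ha hu)
  rw [one_smul] at h
  have e : rotationPath s (a + t) = rotationPath (s + a) t := by
    simp [rotationPath, add_assoc]
  rw [← e]
  exact h

lemma coe_natCast_eq_zero (n : ℕ) : ((n : ℝ) : UnitAddCircle) = 0 := by
  exact (AddCircle.coe_eq_zero_iff (1 : ℝ)).2 ⟨n, by simp⟩

lemma IsSimplexSolution.shift_nat {s : UnitAddCircle} {θ : ℝ → Simplex d}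
    (hθ : IsSimplexSolution A (rotationPath s) (Ici 0) θ) (n : ℕ) :
    IsSimplexSolution A (rotationPath s) (Ici 0) (fun t => θ (n + t)) := by
  have := hθ.shift n.cast_nonneg
  rwa [coe_natCast_eq_zero, add_zero] at this

/-- A cluster point of the period map orbit is fixed, hence gives a periodic solution. -/
lemma exists_periodic_isSimplexSolution (hd : 1 ≤ d) (hA : Continuous A)
    (hM : ∀ s, IsMetzler (A s))
    (hirr : IsIrreducible (averageMatrix A (volume : Measure UnitAddCircle))) (s : UnitAddCircle) :
    ∃ φ : ℝ → Simplex d, IsSimplexSolution A (rotationPath s) (Ici 0) φ ∧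
      ∀ t, 0 ≤ t → φ (t + 1) = φ t := by
  have hwp := wellPosed hA hM
  let θ₀ : Simplex d := ⟨_, single_mem_stdSimplex ℝ (⟨0, hd⟩ : Fin d)⟩
  set θ := simplexFlow A s θ₀
  have hθ : IsSimplexSolution A (rotationPath s) (Ici 0) θ :=
    (isSimplexSolution_simplexFlow hwp s θ₀).1
  obtain ⟨p, ψ, hψ, hp⟩ := CompactSpace.tendsto_subseq fun n : ℕ => θ n
  have hT : Continuous fun q => simplexFlow A s q 1 :=
    (continuous_simplexFlow hA hM zero_le_one).comp (by fun_prop : Continuous fun q => (s, q))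
  have hstep : ∀ n : ℕ, simplexFlow A s (θ n) 1 = θ (n + 1) := fun n => by
    simpa using simplexFlow_eq hwp (hθ.shift_nat n) zero_le_one
  have h1 : Tendsto (fun k => (simplexFlow A s (θ (ψ k)) 1 : Fin d → ℝ) - (θ (ψ k) : Fin d → ℝ))
      atTop (𝓝 ((simplexFlow A s p 1 : Fin d → ℝ) - (p : Fin d → ℝ))) :=
    ((continuous_subtype_val.tendsto _).comp ((hT.tendsto p).comp hp)).sub
      ((continuous_subtype_val.tendsto _).comp hp)
  -- The shift of `θ` by one period solves the same equation, so it merges with `θ`.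
  have h2 : Tendsto (fun k => (simplexFlow A s (θ (ψ k)) 1 : Fin d → ℝ) - (θ (ψ k) : Fin d → ℝ))
      atTop (𝓝 0) := by
    have := (tendsto_sub_of_isSimplexSolution hA hM hirr (hθ.shift_nat 1) hθ).comp
      (tendsto_natCast_atTop_atTop.comp hψ.tendsto_atTop)
    refine this.congr fun k => ?_
    simp [hstep, add_comm]
  have hfix : simplexFlow A s p 1 = p := stdSimplex.ext (sub_eq_zero.1 (tendsto_nhds_unique h1 h2))
  obtain ⟨hφ, hφ0⟩ := isSimplexSolution_simplexFlow hwp s p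
  refine ⟨simplexFlow A s p, hφ, fun t ht => ?_⟩
  have := simplexFlow_eq hwp (hφ.shift_nat 1) ht
  simp only [Nat.cast_one, add_zero, hfix] at this
  rw [this, add_comm]

/-- The periodic solution on `[0, ∞)` with phase `0` is extended by `Int.fract`. Near `t` the
extension is `u ↦ φ (u + n)` with `t + n > 0`, which gives two-sided derivatives, at integers too.
-/
lemma exists_periodic_hasDerivAt (hd : 1 ≤ d) (hA : Continuous A)
    (hM : ∀ s, IsMetzler (A s))
    (hirr : IsIrreducible (averageMatrix A (volume : Measure UnitAddCircle))) :
    ∃ θ : ℝ → Simplex d, Function.Periodic θ 1 ∧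
      ∀ t : ℝ, HasDerivAt (fun u => (θ u : Fin d → ℝ)) (simplexField A (t : UnitAddCircle) (θ t)) t := by
  obtain ⟨φ, hφ, hper⟩ := exists_periodic_isSimplexSolution hd hA hM hirr 0
  have hnat : ∀ (n : ℕ) (t : ℝ), 0 ≤ t → φ (t + n) = φ t := by
    intro n
    induction n with
    | zero => simp
    | succ n ih =>
      intro t ht
      push_cast
      rw [← add_assoc, hper _ (by positivity), ih t ht]
  have hfract : ∀ (n : ℕ) (t : ℝ), 0 ≤ t + n → φ (Int.fract t) = φ (t + n) := by
    intro n t ht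
    obtain ⟨m, hm⟩ := Int.eq_ofNat_of_zero_le (Int.floor_nonneg.2 ht)
    rw [← Int.fract_add_natCast t n]
    conv_rhs => rw [← Int.fract_add_floor (t + n), hm]
    exact (hnat m _ (Int.fract_nonneg _)).symm
  refine ⟨fun t => φ (Int.fract t), fun t => by simp only [Int.fract_add_one], fun t => ?_⟩
  obtain ⟨n, hn⟩ := exists_nat_gt (-t)
  have htn : 0 < t + n := by linarith
  have hd1 : HasDerivAt (fun u => (φ u : Fin d → ℝ))
      (simplexField A (rotationPath 0 (t + n)) (φ (t + n))) (t + n) :=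
    (hφ _ htn.le).hasDerivAt (Ici_mem_nhds htn)
  have hd2 := hd1.comp_add_const t n
  have e : rotationPath 0 (t + n) = (t : UnitAddCircle) := by
    simp [rotationPath, coe_natCast_eq_zero]
  rw [e, ← hfract n t htn.le] at hd2
  refine hd2.congr_of_eventuallyEq ?_
  have : ∀ᶠ u : ℝ in 𝓝 t, 0 < u + n :=
    (by fun_prop : Continuous fun u : ℝ => u + n).tendsto t |>.eventually_const_lt htn
  filter_upwards [this] with u hu
  rw [hfract n u hu.le]

variable {θ : ℝ → Simplex d}

lemma isSimplexSolution_of_hasDerivAt (hθ : ∀ t : ℝ, HasDerivAt (fun u => (θ u : Fin d → ℝ))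
    (simplexField A (t : UnitAddCircle) (θ t)) t) (s : ℝ) (I : Set ℝ) :
    IsSimplexSolution A (rotationPath (s : UnitAddCircle)) I (fun t => θ (s + t)) := by
  intro t _
  rw [rotationPath_coe]
  exact ((hθ (s + t)).comp_const_add s t).hasDerivWithinAt

lemma continuous_of_hasDerivAt (hθ : ∀ t : ℝ, HasDerivAt (fun u => (θ u : Fin d → ℝ))
    (simplexField A (t : UnitAddCircle) (θ t)) t) : Continuous θ :=
  continuous_induced_rng.2 (continuous_iff_continuousAt.2 fun t => (hθ t).continuousAt)

end PeriodicSolution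

/-! ### The invariant probability and the Lyapunov exponent -/

section InvariantMeasure

variable {d : ℕ} {A : UnitAddCircle → Matrix (Fin d) (Fin d) ℝ} {θ : ℝ → Simplex d}

instance : IsProbabilityMeasure (volume : Measure UnitAddCircle) := ⟨UnitAddCircle.measure_univ⟩

lemma continuous_periodic_lift (hper : Function.Periodic θ 1) (hc : Continuous θ) :
    Continuous (hper.lift : UnitAddCircle → Simplex d) :=
  hc.quotient_lift _

lemma graphMeasure_eq_map (hper : Function.Periodic θ 1) (hc : Continuous θ) :
    graphMeasure θ = (volume : Measure UnitAddCircle).map fun s => (s, hper.lift s) := by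
  have hmp := UnitAddCircle.measurePreserving_mk 0
  rw [zero_add] at hmp
  have hm : Measurable fun s : UnitAddCircle => (s, (hper.lift s : Simplex d)) :=
    (continuous_id.prodMk (continuous_periodic_lift hper hc)).measurable
  rw [← hmp.map_eq, Measure.map_map hm hmp.measurable, graphMeasure,
    Measure.restrict_congr_set Ico_ae_eq_Ioc]
  rfl

lemma integral_graphMeasure (hper : Function.Periodic θ 1) (hc : Continuous θ)
    {f : UnitAddCircle × Simplex d → ℝ} (hf : Measurable f) :
    ∫ p, f p ∂(graphMeasure θ) = ∫ s : UnitAddCircle, f (s, hper.lift s) := by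
  rw [graphMeasure_eq_map hper hc, integral_map _ hf.aestronglyMeasurable]
  exact (continuous_id.prodMk (continuous_periodic_lift hper hc)).aemeasurable

lemma isProbabilityMeasure_graphMeasure (hper : Function.Periodic θ 1) (hc : Continuous θ) :
    IsProbabilityMeasure (graphMeasure θ) := by
  rw [graphMeasure_eq_map hper hc]
  exact Measure.isProbabilityMeasure_map
    (continuous_id.prodMk (continuous_periodic_lift hper hc)).aemeasurable

/-- The graph of the periodic solution is carried into itself, the flow acting on it as a rotation.
-/
lemma simplexFlow_lift (hwp : WellPosed A) (hper : Function.Periodic θ 1)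
    (hθ : ∀ t : ℝ, HasDerivAt (fun u => (θ u : Fin d → ℝ))
      (simplexField A (t : UnitAddCircle) (θ t)) t) (s : UnitAddCircle) {t : ℝ} (ht : 0 ≤ t) :
    simplexFlow A s (hper.lift s) t = hper.lift (s + (t : UnitAddCircle)) := by
  induction s using QuotientAddGroup.induction_on with
  | H s =>
    have := simplexFlow_eq hwp (isSimplexSolution_of_hasDerivAt hθ s (Ici 0)) ht
    rw [add_zero] at this
    exact this

lemma measurable_semigroup (hA : Continuous A) (hM : ∀ s, IsMetzler (A s)) {t : ℝ} (ht : 0 ≤ t)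
    {f : UnitAddCircle × Simplex d → ℝ} (hf : Measurable f) : Measurable (semigroup A t f) := by
  refine hf.comp (Continuous.measurable (Continuous.prodMk ?_ (continuous_simplexFlow hA hM ht)))
  exact continuous_rotationPath.comp
    (by fun_prop : Continuous fun p : UnitAddCircle × Simplex d => (p.1, t))

lemma isInvariantProbability_graphMeasure (hA : Continuous A) (hM : ∀ s, IsMetzler (A s))
    (hper : Function.Periodic θ 1)
    (hθ : ∀ t : ℝ, HasDerivAt (fun u => (θ u : Fin d → ℝ))
      (simplexField A (t : UnitAddCircle) (θ t)) t) :
    IsInvariantProbability A (graphMeasure θ) := by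
  have hc := continuous_of_hasDerivAt hθ
  refine ⟨isProbabilityMeasure_graphMeasure hper hc, fun t ht f hf _ => ?_⟩
  rw [integral_graphMeasure hper hc (measurable_semigroup hA hM ht hf),
    integral_graphMeasure hper hc hf,
    ← integral_add_right_eq_self (fun s => f (s, hper.lift s)) (t : UnitAddCircle)]
  simp only [semigroup, simplexFlow_lift (wellPosed hA hM) hper hθ _ ht]
  rfl

/-- The first marginal of an invariant probability is Lebesgue measure. -/
lemma IsInvariantProbability.map_fst {π : Measure (UnitAddCircle × Simplex d)}
    (hπ : IsInvariantProbability A π) : π.map Prod.fst = volume := by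
  have := hπ.1
  have hprob : IsProbabilityMeasure (π.map Prod.fst) :=
    Measure.isProbabilityMeasure_map measurable_fst.aemeasurable
  have hinv : (π.map Prod.fst).IsAddLeftInvariant := by
    refine ⟨fun g => ?_⟩
    -- Invariance is known only for `t ≥ 0`, but every point of the circle has a representative in
    -- `[0, 1)`.
    obtain ⟨t, ht, rfl⟩ : ∃ t : ℝ, 0 ≤ t ∧ (t : UnitAddCircle) = g := by
      have : g ∈ ((↑) : ℝ → UnitAddCircle) '' Ico 0 (0 + 1) := by
        rw [AddCircle.coe_image_Ico_eq]; trivial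
      obtain ⟨t, ht, rfl⟩ := this
      exact ⟨t, ht.1, rfl⟩
    have hm : Measurable fun x : UnitAddCircle => (t : UnitAddCircle) + x := measurable_const_add _
    have : IsProbabilityMeasure ((π.map Prod.fst).map fun x => (t : UnitAddCircle) + x) :=
      Measure.isProbabilityMeasure_map hm.aemeasurable
    refine ext_of_forall_integral_eq_of_IsFiniteMeasure fun f => ?_
    have hf : Measurable f := f.continuous.measurable
    rw [integral_map hm.aemeasurable hf.aestronglyMeasurable,
      integral_map measurable_fst.aemeasurable (f := fun x => f (t + x))
        (hf.comp hm).aestronglyMeasurable,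
      integral_map measurable_fst.aemeasurable hf.aestronglyMeasurable,
      ← hπ.2 t ht (fun p => f p.1) (hf.comp measurable_fst) ⟨‖f‖, fun p => f.norm_coe_le_norm _⟩]
    simp only [semigroup, rotationPath, add_comm]
  have hhaar : (π.map Prod.fst).IsAddHaarMeasure :=
    Measure.isAddHaarMeasure_of_isCompact_nonempty_interior _ univ isCompact_univ
      (by simp) (by simp) (by simp)
  exact Measure.isAddHaarMeasure_eq_of_isProbabilityMeasure _ _

/-- At integer times the phase returns to `s` while the flow tends to `hper.lift s`. Dominated
convergence turns `∫ f dπ` into the integral of `f (s, hper.lift s)`, which involves only the first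
marginal. -/
lemma IsInvariantProbability.eq_graphMeasure (hA : Continuous A) (hM : ∀ s, IsMetzler (A s))
    (hirr : IsIrreducible (averageMatrix A (volume : Measure UnitAddCircle)))
    (hper : Function.Periodic θ 1)
    (hθ : ∀ t : ℝ, HasDerivAt (fun u => (θ u : Fin d → ℝ))
      (simplexField A (t : UnitAddCircle) (θ t)) t)
    {π : Measure (UnitAddCircle × Simplex d)} (hπ : IsInvariantProbability A π) :
    π = graphMeasure θ := by
  have hc := continuous_of_hasDerivAt hθ
  have hwp := wellPosed hA hM
  have := hπ.1
  have := isProbabilityMeasure_graphMeasure hper hc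
  have hlift := continuous_periodic_lift hper hc
  have hflow : ∀ s θ₀, Tendsto (fun n : ℕ => simplexFlow A s θ₀ n) atTop (𝓝 (hper.lift s)) := by
    intro s θ₀
    refine tendsto_subtype_rng.2 ?_
    have h := (tendsto_sub_of_isSimplexSolution hA hM hirr
      (isSimplexSolution_simplexFlow hwp s θ₀).1
      (isSimplexSolution_simplexFlow hwp s (hper.lift s)).1).comp tendsto_natCast_atTop_atTop
    have h' := h.add_const ((hper.lift s : Simplex d) : Fin d → ℝ)
    rw [zero_add] at h'
    refine h'.congr fun n => ?_
    simp [simplexFlow_lift hwp hper hθ s n.cast_nonneg, coe_natCast_eq_zero]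
    rfl
  refine ext_of_forall_integral_eq_of_IsFiniteMeasure fun f => ?_
  have hf : Measurable f := f.continuous.measurable
  have hg : Measurable fun s : UnitAddCircle => f (s, hper.lift s) :=
    (f.continuous.comp (continuous_id.prodMk hlift)).measurable
  have hlim : Tendsto (fun n : ℕ => ∫ p, semigroup A n f p ∂π) atTop
      (𝓝 (∫ p, f (p.1, hper.lift p.1) ∂π)) := by
    refine tendsto_integral_of_dominated_convergence (fun _ => ‖f‖)
      (fun n => (measurable_semigroup hA hM n.cast_nonneg hf).aestronglyMeasurable)
      (integrable_const _) (fun n => ae_of_all _ fun p => f.norm_coe_le_norm _)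
      (ae_of_all _ fun p => ?_)
    have hp : ∀ n : ℕ, semigroup A n f p = f (p.1, simplexFlow A p.1 p.2 n) := fun n => by
      simp only [semigroup, rotationPath, coe_natCast_eq_zero, add_zero]
    simp only [hp]
    exact (f.continuous.tendsto _).comp (tendsto_const_nhds.prodMk_nhds (hflow p.1 p.2))
  have hconst : ∀ n : ℕ, ∫ p, semigroup A n f p ∂π = ∫ p, f p ∂π := fun n =>
    hπ.2 n n.cast_nonneg f hf ⟨‖f‖, fun p => f.norm_coe_le_norm _⟩
  simp only [hconst] at hlim
  rw [tendsto_nhds_unique tendsto_const_nhds hlim, integral_graphMeasure hper hc hf, ← hπ.map_fst,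
    integral_map measurable_fst.aemeasurable hg.aestronglyMeasurable]

lemma topLyapunov_graphMeasure (hA : Continuous A) (hper : Function.Periodic θ 1)
    (hc : Continuous θ) : topLyapunov A (graphMeasure θ)
      = ∫ s in (0 : ℝ)..1, growthRate A (s : UnitAddCircle) (θ s) := by
  have hg : Continuous fun p : UnitAddCircle × Simplex d => growthRate A p.1 p.2 := by
    unfold growthRate
    exact ((hA.comp continuous_fst).matrix_mulVec
      (continuous_subtype_val.comp continuous_snd)).dotProduct continuous_const
  have h := UnitAddCircle.intervalIntegral_preimage 0
    (fun s => growthRate A s (hper.lift s : Simplex d))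
  rw [zero_add] at h
  rw [topLyapunov, integral_graphMeasure hper hc hg.measurable, ← h]
  rfl

end InvariantMeasure

end Cooperative

/-! ### The main theorem -/

open Cooperative in
theorem proposition2 (d : ℕ) (hd : 1 ≤ d)
    (A : UnitAddCircle → Matrix (Fin d) (Fin d) ℝ) (hA : Continuous A)
    (hMetzler : ∀ s, IsMetzler (A s))
    (hirr : IsIrreducible (averageMatrix A (volume : Measure UnitAddCircle))) :
    WellPosed A ∧
    ∃ θstar : ℝ → Simplex d, Continuous θstar ∧ Function.Periodic θstar 1 ∧
      (∀ s : ℝ,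
        -- `t ↦ θstar (s + t)` is a solution (for all real times), and it is 1-periodic
        IsSimplexSolution A (rotationPath (s : UnitAddCircle)) univ (fun t => θstar (s + t)) ∧
        -- it is the only 1-periodic solution, even among solutions for `t ≥ 0`
        (∀ θ : ℝ → Simplex d,
          IsSimplexSolution A (rotationPath (s : UnitAddCircle)) (Ici 0) θ →
          (∀ t, 0 ≤ t → θ (t + 1) = θ t) → ∀ t, 0 ≤ t → θ t = θstar (s + t)) ∧
        -- global asymptotic stability
        (∀ θ : ℝ → Simplex d,
          IsSimplexSolution A (rotationPath (s : UnitAddCircle)) (Ici 0) θ →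
          Tendsto (fun t => ‖(θ t : Fin d → ℝ) - (θstar (s + t) : Fin d → ℝ)‖) atTop (𝓝 0))) ∧
      -- the invariant probability exists, is unique, and is `ds δ_{θstar s}`
      (∃! π : Measure (UnitAddCircle × Simplex d), IsInvariantProbability A π) ∧
      (∀ π : Measure (UnitAddCircle × Simplex d), IsInvariantProbability A π →
        π = graphMeasure θstar ∧
        topLyapunov A π = ∫ s in (0 : ℝ)..1, growthRate A (s : UnitAddCircle) (θstar s)) := by
  obtain ⟨θ, hper, hθ⟩ := exists_periodic_hasDerivAt hd hA hMetzler hirr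
  have hc := continuous_of_hasDerivAt hθ
  have hlim : ∀ (s : ℝ) (ϑ : ℝ → Simplex d),
      IsSimplexSolution A (rotationPath (s : UnitAddCircle)) (Ici 0) ϑ →
      Tendsto (fun t => (ϑ t : Fin d → ℝ) - (θ (s + t) : Fin d → ℝ)) atTop (𝓝 0) :=
    fun s ϑ hϑ => tendsto_sub_of_isSimplexSolution hA hMetzler hirr hϑ
      (isSimplexSolution_of_hasDerivAt hθ s (Ici 0))
  refine ⟨wellPosed hA hMetzler, θ, hc, hper, fun s => ⟨isSimplexSolution_of_hasDerivAt hθ s univ,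
    fun ϑ hϑ hϑper t ht => ?_, fun ϑ hϑ => tendsto_zero_iff_norm_tendsto_zero.1 (hlim s ϑ hϑ)⟩,
    ⟨graphMeasure θ, isInvariantProbability_graphMeasure hA hMetzler hper hθ,
      fun π hπ => hπ.eq_graphMeasure hA hMetzler hirr hper hθ⟩, fun π hπ => ?_⟩
  · have hnat : ∀ n : ℕ, ϑ (t + n) = ϑ t := by
      intro n
      induction n with
      | zero => simp
      | succ n ih =>
        push_cast
        rw [← add_assoc, hϑper _ (by positivity), ih]
    have hshift : Tendsto (fun n : ℕ => t + (n : ℝ)) atTop atTop :=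
      tendsto_atTop_add_const_left _ _ tendsto_natCast_atTop_atTop
    -- Along `t + n` the difference of two periodic solutions is constant, yet tends to zero.
    have h : Tendsto (fun _ : ℕ => (ϑ t : Fin d → ℝ) - (θ (s + t) : Fin d → ℝ)) atTop (𝓝 0) := by
      refine ((hlim s ϑ hϑ).comp hshift).congr fun n => ?_
      have hn : θ (s + (t + n)) = θ (s + t) := by
        rw [← add_assoc]
        simpa using hper.nat_mul n (s + t)
      simp only [Function.comp_apply, hnat, hn]
    exact stdSimplex.ext (sub_eq_zero.1 (tendsto_nhds_unique tendsto_const_nhds h))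
  · obtain rfl := hπ.eq_graphMeasure hA hMetzler hirr hper hθ
    exact ⟨rfl, topLyapunov_graphMeasure hA hper hc⟩
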